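/- Let $m\ge 1$, let $W$ be an $n$-dimensional vector space over a finite field $\mathbb{F}_q$, and let $G\in\{\mathrm{GL}(W),\mathrm{SL}(W)\}$ act diagonally on $mW=W\oplus\dots\oplus W$ ($m$ copies). Write $\mathbb{F}_q[mW]=\mathbb{F}_q[x_{ij}\mid 1\le i\le m,\,1\le j\le n]$ with respect to a basis of $W$, where $x_{ij}$ is the $j$-th coordinate on the $i$-th copy. Then there are $mn$ homogeneous invariant polynomials $f_1,\dots,f_{mn}\in\mathbb{F}_q[mW]^G$ such that $\mathbb{F}_q(mW)^G=\mathbb{F}_q(f_1,\dots,f_{mn})$. Explicitly, let $n\ge 1$, put $X_i={}^t(x_{i1},\dots,x_{in})$, and let powers of a column be taken entrywise. Let $L_0$ be the $n\times n$ matrix $$L_0=\begin{cases}(X_1,\dots,X_n), & m\ge n,\\ (X_1,\dots,X_{m-1},X_m^{q^{n-m}},X_m,X_m^{q},\dots,X_m^{q^{n-m-1}}), & m<n.\end{cases}$$ For $1\le i\le m$ and $1\le j\le n$ let $L_{ij}$ be obtained from $L_0$ by replacing its $j$-th column by the $q$-th power of the $i$-th column of $L_0$ if $i\le n$, and by $X_i$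 if $i>n$. Put $\ell_0=\det L_0$ and $\ell_{ij}=\det L_{ij}$. Let $(a,b)$ be any pair with $1\le a\le\min\{m,n\}$, $1\le b\le n$ and, if $m<n$, $b\in\{1,\dots,m-1,m+1\}$; such a pair exists. Then: 1. $\ell_0^{q-1}$ and the $\ell_0^{q-2}\ell_{ij}$ with $1\le i\le m$, $1\le j\le n$, $(i,j)\ne(a,b)$, are $mn$ homogeneous elements of $\mathbb{F}_q[mW]^{\mathrm{GL}(W)}$, and they generate $\mathbb{F}_q(mW)^{\mathrm{GL}(W)}$ as a field over $\mathbb{F}_q$. 2. $\ell_0$ and the $\ell_{ij}$ with $1\le i\le m$, $1\le j\le n$, $(i,j)\ne(a,b)$, are $mn$ homogeneous elements of $\mathbb{F}_q[mW]^{\mathrm{SL}(W)}$, and they generate $\mathbb{F}_q(mW)^{\mathrm{SL}(W)}$ as a field over $\mathbb{F}_q$. -/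

import Mathlib

open Module MvPolynomial

noncomputable section

namespace VectorInvariants

universe u v

variable {F : Type u} [Field F] {W : Type v} [AddCommGroup W] [Module F W] {n : ℕ}

/-- The polynomial ring `F[mW] = F[x_{ij}]`, where `x_{ij}` (written `X (i, j)`) is the `j`-th
coordinate, with respect to a basis of `W`, on the `i`-th summand of `mW = W ⊕ ⋯ ⊕ W`.
All indices are counted from `0`. -/
abbrev Poly (F : Type u) [Field F] (m n : ℕ) : Type u := MvPolynomial (Fin m × Fin n) F

/-- The field of rational functions `F(mW)`. -/
abbrev RatFun (F : Type u) [Field F] (m n : ℕ) : Type u := FractionRing (Poly F m n)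

/-- The linear functional `φ` on `W`, applied to the `i`-th summand of `mW`, as a linear form in
the coordinates of `mW` given by the basis `b` of `W`. -/
def linForm (b : Basis (Fin n) F W) {m : ℕ} (i : Fin m) (φ : Dual F W) : Poly F m n :=
  ∑ k, C (φ (b k)) * X (i, k)

/-- The algebra endomorphism `f ↦ f ∘ σ⁻¹` of `F[mW]` given by `σ ∈ GL(W)` acting diagonally on
`mW`: the coordinate `x_{ij}` goes to the `j`-th coordinate functional composed with `σ⁻¹`, on the
`i`-th summand. -/
def actHom (b : Basis (Fin n) F W) (m : ℕ) (σ : W ≃ₗ[F] W) : Poly F m n →ₐ[F] Poly F m n :=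
  aeval fun p => linForm b p.1 (b.coord p.2 ∘ₗ (σ⁻¹ : W ≃ₗ[F] W).toLinearMap)

theorem actHom_linForm (b : Basis (Fin n) F W) {m : ℕ} (σ : W ≃ₗ[F] W) (i : Fin m)
    (φ : Dual F W) :
    actHom b m σ (linForm b i φ) = linForm b i (φ ∘ₗ (σ⁻¹ : W ≃ₗ[F] W).toLinearMap) := by
  simp only [actHom, linForm, map_sum, map_mul, aeval_X, algHom_C, Finset.mul_sum,
    algebraMap_eq]
  rw [Finset.sum_comm]
  refine Finset.sum_congr rfl fun l _ => ?_
  simp only [← mul_assoc, ← C_mul, ← Finset.sum_mul, ← map_sum]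
  congr 2
  have h := congrArg φ (b.sum_repr ((σ⁻¹ : W ≃ₗ[F] W) (b l)))
  simp only [map_sum, map_smul, smul_eq_mul] at h
  simp only [LinearMap.comp_apply, LinearEquiv.coe_coe, Basis.coord_apply]
  rw [← h]
  exact Finset.sum_congr rfl fun k _ => mul_comm _ _

theorem linForm_coord (b : Basis (Fin n) F W) {m : ℕ} (i : Fin m) (j : Fin n) :
    linForm b i (b.coord j) = X (i, j) := by
  simp [linForm, Finsupp.single_apply]

theorem actHom_one (b : Basis (Fin n) F W) (m : ℕ) :
    actHom b m 1 = AlgHom.id F (Poly F m n) := by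
  refine algHom_ext fun p => ?_
  have h : b.coord p.2 ∘ₗ ((1 : W ≃ₗ[F] W)⁻¹ : W ≃ₗ[F] W).toLinearMap = b.coord p.2 := by
    ext; simp
  simp only [actHom, aeval_X, h, linForm_coord, AlgHom.id_apply]

theorem actHom_mul (b : Basis (Fin n) F W) (m : ℕ) (σ τ : W ≃ₗ[F] W) :
    actHom b m (σ * τ) = (actHom b m σ).comp (actHom b m τ) := by
  refine algHom_ext fun p => ?_
  have h : actHom b m τ (X p) =
      linForm b p.1 (b.coord p.2 ∘ₗ (τ⁻¹ : W ≃ₗ[F] W).toLinearMap) := by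
    simp [actHom]
  rw [AlgHom.comp_apply, h, actHom_linForm, actHom, aeval_X, mul_inv_rev]
  rfl

/-- The action of `GL(W)` on `F[mW]` by algebra automorphisms, `σ ↦ (f ↦ f ∘ σ⁻¹)`. -/
def act (b : Basis (Fin n) F W) (m : ℕ) : (W ≃ₗ[F] W) →* (Poly F m n ≃ₐ[F] Poly F m n) where
  toFun σ := AlgEquiv.ofAlgHom (actHom b m σ) (actHom b m σ⁻¹)
    (by rw [← actHom_mul, mul_inv_cancel, actHom_one])
    (by rw [← actHom_mul, inv_mul_cancel, actHom_one])
  map_one' := by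
    ext f : 1
    exact DFunLike.congr_fun (actHom_one b m) f
  map_mul' σ τ := by
    ext f : 1
    exact DFunLike.congr_fun (actHom_mul b m σ τ) f

/-- The induced action of `GL(W)` on the field `F(mW)`. -/
def actField (b : Basis (Fin n) F W) (m : ℕ) :
    (W ≃ₗ[F] W) →* (RatFun F m n ≃ₐ[F] RatFun F m n) :=
  (IsFractionRing.fieldEquivOfAlgEquivHom F (RatFun F m n)).comp (act b m)

/-- The vector invariant ring `F[mW]^G` of a subgroup `G` of `GL(W)`. -/
def invariantRing (b : Basis (Fin n) F W) (m : ℕ) (G : Subgroup (W ≃ₗ[F] W)) :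
    Subalgebra F (Poly F m n) where
  carrier := {f | ∀ σ ∈ G, act b m σ f = f}
  mul_mem' hf hg σ hσ := by rw [map_mul, hf σ hσ, hg σ hσ]
  add_mem' hf hg σ hσ := by rw [map_add, hf σ hσ, hg σ hσ]
  algebraMap_mem' r σ _ := (act b m σ).commutes r

/-- The vector invariant field `F(mW)^G` of a subgroup `G` of `GL(W)`. -/
def invariantField (b : Basis (Fin n) F W) (m : ℕ) (G : Subgroup (W ≃ₗ[F] W)) :
    IntermediateField F (RatFun F m n) :=
  IntermediateField.fixedField (G.map (actField b m))

/-- The general linear group `GL(W)`, as a subgroup of itself. -/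
def GLgroup (F : Type u) [Field F] (W : Type v) [AddCommGroup W] [Module F W] :
    Subgroup (W ≃ₗ[F] W) := ⊤

/-- The special linear group `SL(W)`: the automorphisms of determinant `1`. -/
def SLgroup (F : Type u) [Field F] (W : Type v) [AddCommGroup W] [Module F W] :
    Subgroup (W ≃ₗ[F] W) := (LinearEquiv.det : (W ≃ₗ[F] W) →* Fˣ).ker

section Steinberg

variable (F : Type u) [Field F] [Fintype F] {m : ℕ} (n : ℕ)

/-- The column vector `X_i^{q^k} = (x_{i1}^{q^k}, …, x_{in}^{q^k})`, where `q = |F|`. -/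
def powCol (i : Fin m) (k : ℕ) : Fin n → Poly F m n :=
  fun r => X (i, r) ^ (Fintype.card F ^ k)

/-- The columns of `L_0`. With columns and vectors counted from `1` they are
`X_1, …, X_n` if `n ≤ m`, and
`X_1, …, X_{m-1}, X_m^{q^{n-m}}, X_m, X_m^q, …, X_m^{q^{n-m-1}}` if `m < n`. -/
def baseCol (hm : 0 < m) (k : Fin n) : Fin n → Poly F m n :=
  if h : n ≤ m then powCol F n ⟨k, k.2.trans_le h⟩ 0
  else if h' : (k : ℕ) + 1 < m then powCol F n ⟨k, by omega⟩ 0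
  else if (k : ℕ) + 1 = m then powCol F n ⟨m - 1, by omega⟩ (n - m)
  else powCol F n ⟨m - 1, by omega⟩ (k - m)

/-- The matrix `L_0`. -/
def L0 (hm : 0 < m) : Matrix (Fin n) (Fin n) (Poly F m n) :=
  Matrix.of fun r k => baseCol F n hm k r

/-- The column used to form `L_{ij}`: the `q`-th power of the `i`-th column of `L_0` if `i` is one
of the first `n` indices, and the vector `X_i` otherwise (which occurs only if `n < m`). -/
def newCol (hm : 0 < m) (i : Fin m) : Fin n → Poly F m n :=
  if h : (i : ℕ) < n then fun r => baseCol F n hm ⟨i, h⟩ r ^ Fintype.card F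
  else powCol F n i 0

/-- `ℓ_0 = det L_0`. -/
def ell0 (hm : 0 < m) : Poly F m n := (L0 F n hm).det

/-- `ℓ_{ij} = det L_{ij}`, where `L_{ij}` is `L_0` with its `j`-th column replaced. -/
def ell (hm : 0 < m) (i : Fin m) (j : Fin n) : Poly F m n :=
  ((L0 F n hm).updateCol j (newCol F n hm i)).det

/-- The `mn` polynomials `ℓ_0^{q-1}` and `ℓ_0^{q-2} ℓ_{ij}`, `(i, j) ≠ a`, with `ℓ_0^{q-1}` put in
the place of index `a`. -/
def genGL (hm : 0 < m) (a : Fin m × Fin n) (p : Fin m × Fin n) : Poly F m n :=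
  if p = a then ell0 F n hm ^ (Fintype.card F - 1)
  else ell0 F n hm ^ (Fintype.card F - 2) * ell F n hm p.1 p.2

/-- The `mn` polynomials `ℓ_0` and `ℓ_{ij}`, `(i, j) ≠ a`, with `ℓ_0` put in the place of
index `a`. -/
def genSL (hm : 0 < m) (a : Fin m × Fin n) (p : Fin m × Fin n) : Poly F m n :=
  if p = a then ell0 F n hm else ell F n hm p.1 p.2

end Steinberg

/-- The pairs `(i, j)` for which `ℓ_{ij}` may be left out. Counted from `1`: those with
`i ≤ min(m, n)` and, if `m < n`, also `j ∈ {1, …, m - 1, m + 1}`. -/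
def Omittable {m n : ℕ} (a : Fin m × Fin n) : Prop :=
  (a.1 : ℕ) < n ∧ (m < n → (a.2 : ℕ) + 1 < m ∨ (a.2 : ℕ) = m)

/-- The polynomials `f_p` are homogeneous invariants of `G` that generate `F(mW)^G` as a field
extension of `F`. -/
def GenerateInvariants (b : Basis (Fin n) F W) {m : ℕ} (G : Subgroup (W ≃ₗ[F] W))
    {ι : Type*} (f : ι → Poly F m n) : Prop :=
  (∀ p, (∃ d, (f p).IsHomogeneous d) ∧ f p ∈ invariantRing b m G) ∧
    invariantField b m G =
      IntermediateField.adjoin F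
        (Set.range fun p => algebraMap (Poly F m n) (RatFun F m n) (f p))

end VectorInvariants

end

/-! Let K = F(mW), q = |F|, and let Y be `L0` over K; Y is invertible because its columns are
distinct powers X_i^{q^e}. Entrywise q-th powers give Y^(q) = Y D. The order of the columns is
chosen so that each column of D is a column of ratios ℓ_ij/ℓ_0 or a standard basis vector, and so
that each X_i is Y times a column of one of these two kinds.

Let E be a field between F and K containing all the ratios. If embeddings τ, ι of K agree on E, then
B = τ(Y) ι(Y)⁻¹ satisfies B^(q) = B, so B has entries in F and τ is ι composed with an element of
GL(W) (`exists_actField_of_ringHom`). Moreover K/E is separable: an E-derivation d has 0 = d(Y^(q))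
= dY · D, and det D = ℓ_0^(q-1) is nonzero. Comparing conjugates, E contains every x fixed by all σ
that fix E (`mem_of_forall_actField_eq`). For SL(W), such σ have determinant 1 because ℓ_0 lies in
E.

One ratio can be omitted because det D = ℓ_0^(q-1) is an equation of degree one in it, with nonzero
leading coefficient in E (`ratio_mem_of_omitted`). -/

noncomputable section

namespace VectorInvariants

universe u v

/-! ### Determinants of matrices of Frobenius powers -/

section PowMatrix

variable (F : Type u) [Field F] [Fintype F] {m n : ℕ}

/-- The square matrix whose `k`-th column is `X_i^{q^e}`, where `(i, e) = p k`. -/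
def powMatrix (p : Fin n → Fin m × ℕ) : Matrix (Fin n) (Fin n) (Poly F m n) :=
  Matrix.of fun r k => powCol F n (p k).1 (p k).2 r

theorem powMatrix_apply (p : Fin n → Fin m × ℕ) (r k : Fin n) :
    powMatrix F p r k = X ((p k).1, r) ^ (Fintype.card F ^ (p k).2) := rfl

theorem powMatrix_updateCol (p : Fin n → Fin m × ℕ) (j : Fin n) (t : Fin m × ℕ) :
    (powMatrix F p).updateCol j (powCol F n t.1 t.2) = powMatrix F (Function.update p j t) := by
  ext1 r k
  by_cases h : k = j
  · subst h; simp [powMatrix]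
  · simp [powMatrix, Matrix.updateCol_ne h, Function.update_of_ne h]

theorem isHomogeneous_det_powMatrix (p : Fin n → Fin m × ℕ) :
    (powMatrix F p).det.IsHomogeneous (∑ k, Fintype.card F ^ (p k).2) := by
  rw [Matrix.det_apply]
  refine IsHomogeneous.sum _ _ _ fun π _ => ?_
  have h : (∏ k, powMatrix F p (π k) k).IsHomogeneous (∑ k, Fintype.card F ^ (p k).2) :=
    IsHomogeneous.prod _ _ _ fun k _ => isHomogeneous_X_pow _ _
  rw [← mem_homogeneousSubmodule] at h ⊢
  rcases Int.units_eq_one_or (Equiv.Perm.sign π) with hs | hs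
  · simpa [hs] using h
  · simpa [hs] using h

/-- Different permutations give different monomials: the exponents at (i, r) reveal which column
contributed row r, since distinct columns differ in variable or exponent. So the diagonal monomial
cannot cancel. -/
theorem coeff_sum_smul_single_det {p : Fin n → Fin m × ℕ} (hp : Function.Injective p) :
    coeff (∑ k, Finsupp.single ((p k).1, k) (Fintype.card F ^ (p k).2)) (powMatrix F p).det
      = 1 := by
  have hcard : 1 < Fintype.card F := Fintype.one_lt_card
  have hprod : ∀ π : Equiv.Perm (Fin n), ∏ k, powMatrix F p (π k) k =
      monomial (∑ k, Finsupp.single ((p k).1, π k) (Fintype.card F ^ (p k).2)) 1 := by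
    intro π
    rw [monomial_sum_one]
    exact Finset.prod_congr rfl fun k _ => by rw [powMatrix_apply, X_pow_eq_monomial]
  rw [Matrix.det_apply, coeff_sum, Finset.sum_eq_single 1]
  · rw [hprod]; simp
  · intro π _ hπ
    have hc : coeff (∑ k, Finsupp.single ((p k).1, k) (Fintype.card F ^ (p k).2))
        (∏ k, powMatrix F p (π k) k) = 0 := by
      rw [hprod, coeff_monomial, if_neg]
      intro h
      apply hπ
      ext1 k
      have hk := DFunLike.congr_fun h ((p k).1, π k)
      simp only [Finsupp.coe_finsetSum, Finset.sum_apply, Finsupp.single_apply, Prod.mk.injEq,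
        EmbeddingLike.apply_eq_iff_eq] at hk
      have h1 : (∑ x, if (p x).1 = (p k).1 ∧ x = k then Fintype.card F ^ (p x).2 else 0) =
          Fintype.card F ^ (p k).2 := by
        rw [Finset.sum_eq_single k] <;> simp +contextual
      have h2 : (∑ x, if (p x).1 = (p k).1 ∧ x = π k then Fintype.card F ^ (p x).2 else 0) =
          if (p (π k)).1 = (p k).1 then Fintype.card F ^ (p (π k)).2 else 0 := by
        rw [Finset.sum_eq_single (π k)] <;> simp +contextual
      rw [h1, h2] at hk
      split_ifs at hk with h3
      · exact hp (Prod.ext h3 (Nat.pow_right_injective hcard hk.symm))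
      · exact absurd hk (pow_ne_zero _ (by omega))
    rcases Int.units_eq_one_or (Equiv.Perm.sign π) with hs | hs
    · simpa [hs] using hc
    · simpa [hs] using hc
  · simp

theorem det_powMatrix_ne_zero {p : Fin n → Fin m × ℕ} (hp : Function.Injective p) :
    (powMatrix F p).det ≠ 0 := by
  intro h
  have := coeff_sum_smul_single_det F hp
  simp [h] at this

variable {F}

theorem sum_smul_pow_card_pow {R ι : Type*} [CommRing R] [Algebra F R] (s : Finset ι) (c : ι → F)
    (x : ι → R) (e : ℕ) :
    (∑ i ∈ s, algebraMap F R (c i) * x i) ^ (Fintype.card F ^ e) =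
      ∑ i ∈ s, algebraMap F R (c i) * x i ^ (Fintype.card F ^ e) := by
  induction e with
  | zero => simp
  | succ e ih =>
    have h := map_sum (FiniteField.frobeniusAlgHom F R)
      (fun i => algebraMap F R (c i) * x i ^ (Fintype.card F ^ e)) s
    simp only [map_mul, AlgHom.commutes, FiniteField.frobeniusAlgHom_apply] at h
    simp only [pow_succ, pow_mul, ih, h]

end PowMatrix

/-! ### Action of GL(W) on these determinants -/

section Action

variable {F : Type u} [Field F] {m n : ℕ} {W : Type v} [AddCommGroup W] [Module F W]

/-- The matrix of `σ⁻¹`. -/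
def invMatrix (b : Basis (Fin n) F W) (σ : W ≃ₗ[F] W) : Matrix (Fin n) (Fin n) F :=
  LinearMap.toMatrix b b (σ⁻¹ : W ≃ₗ[F] W).toLinearMap

theorem act_X (b : Basis (Fin n) F W) (σ : W ≃ₗ[F] W) (i : Fin m) (r : Fin n) :
    act b m σ (X (i, r)) = ∑ s, algebraMap F (Poly F m n) (invMatrix b σ r s) * X (i, s) := by
  change actHom b m σ (X (i, r)) = _
  simp [actHom, linForm, invMatrix, LinearMap.toMatrix_apply]

theorem det_invMatrix (b : Basis (Fin n) F W) (σ : W ≃ₗ[F] W) :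
    (invMatrix b σ).det = ((LinearEquiv.det σ)⁻¹ : Fˣ) := by
  rw [invMatrix, LinearMap.det_toMatrix, ← map_inv, LinearEquiv.coe_det]

variable [Fintype F]

theorem map_act_powMatrix (b : Basis (Fin n) F W) (σ : W ≃ₗ[F] W) (p : Fin n → Fin m × ℕ) :
    (powMatrix F p).map (act b m σ) =
      (invMatrix b σ).map (algebraMap F (Poly F m n)) * powMatrix F p := by
  ext1 r k
  simp only [Matrix.map_apply, powMatrix_apply, map_pow, act_X, sum_smul_pow_card_pow,
    Matrix.mul_apply]

theorem act_det_powMatrix (b : Basis (Fin n) F W) (σ : W ≃ₗ[F] W) (p : Fin n → Fin m × ℕ) :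
    act b m σ (powMatrix F p).det =
      algebraMap F (Poly F m n) (invMatrix b σ).det * (powMatrix F p).det := by
  have h := map_act_powMatrix b σ p
  have h1 : act b m σ (powMatrix F p).det = ((powMatrix F p).map (act b m σ)).det :=
    RingHom.map_det ((act b m σ : Poly F m n ≃ₐ[F] Poly F m n) : Poly F m n →+* Poly F m n) _
  rw [h1, h, Matrix.det_mul]
  congr 1
  exact (RingHom.map_det (algebraMap F (Poly F m n)) _).symm

end Action

/-! ### Bookkeeping of the columns of L_0 -/

section Indices

variable {m n : ℕ}

/-- The columns of `L_0` are the `X_i^{q^e}` with `(i, e) = baseIdx hm k`. -/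
def baseIdx (hm : 0 < m) (k : Fin n) : Fin m × ℕ :=
  if h : n ≤ m then (⟨k, k.2.trans_le h⟩, 0)
  else if h' : (k : ℕ) + 1 < m then (⟨k, by omega⟩, 0)
  else if (k : ℕ) + 1 = m then (⟨m - 1, by omega⟩, n - m)
  else (⟨m - 1, by omega⟩, k - m)

theorem baseIdx_fst_val (hm : 0 < m) (k : Fin n) :
    ((baseIdx hm k).1 : ℕ) = if n ≤ m ∨ (k : ℕ) + 1 < m then (k : ℕ) else m - 1 := by
  unfold baseIdx
  split_ifs <;> first | rfl | omega

theorem baseIdx_snd (hm : 0 < m) (k : Fin n) :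
    (baseIdx hm k).2 =
      if n ≤ m ∨ (k : ℕ) + 1 < m then 0 else if (k : ℕ) + 1 = m then n - m else k - m := by
  unfold baseIdx
  split_ifs <;> first | rfl | omega

theorem baseIdx_injective (hm : 0 < m) : Function.Injective (baseIdx (n := n) hm) := by
  intro k l h
  ext
  have h1 := congrArg (fun t => (t.1 : ℕ)) h
  have h2 := congrArg Prod.snd h
  have hk := k.2
  have hl := l.2
  unfold baseIdx at h1 h2
  split_ifs at h1 h2 <;> simp at h1 h2 <;> omega

/-- The column of `newCol` as an index pair. -/
def newIdx (n : ℕ) (hm : 0 < m) (i : Fin m) : Fin m × ℕ :=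
  if h : (i : ℕ) < n then ((baseIdx hm ⟨i, h⟩).1, (baseIdx hm ⟨i, h⟩).2 + 1) else (i, 0)

/-- The indices of the `q`-th powers of the columns of `L_0`. -/
def frobIdx (hm : 0 < m) (k : Fin n) : Fin m × ℕ := ((baseIdx hm k).1, (baseIdx hm k).2 + 1)

theorem frobIdx_injective (hm : 0 < m) : Function.Injective (frobIdx (n := n) hm) := by
  intro k l h
  apply baseIdx_injective hm
  simpa [frobIdx, Prod.ext_iff] using h

theorem update_frobIdx_injective (hm : 0 < m) {a : Fin m × Fin n} (ha : Omittable a) :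
    Function.Injective
      (Function.update (frobIdx hm) ⟨a.1, ha.1⟩ (baseIdx hm a.2)) := by
  -- `Omittable` selects the columns of L_0 with exponent 0; these are never q-th powers, so they
  -- differ from every column of L_0^(q).
  have hb : (baseIdx hm a.2).2 = 0 := by
    have := ha.2
    have := a.2.2
    unfold baseIdx
    split_ifs <;> simp <;> omega
  intro k l h
  by_contra hne
  rcases eq_or_ne k ⟨a.1, ha.1⟩ with rfl | hk <;> rcases eq_or_ne l ⟨a.1, ha.1⟩ with rfl | hl
  · exact hne rfl
  · rw [Function.update_self, Function.update_of_ne hl] at h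
    simpa [frobIdx, hb] using congrArg Prod.snd h
  · rw [Function.update_self, Function.update_of_ne hk] at h
    simpa [frobIdx, hb] using congrArg Prod.snd h
  · rw [Function.update_of_ne hl, Function.update_of_ne hk] at h
    exact hne (frobIdx_injective hm h)

/-- The powers of the last vector sit in cyclic order: past position `m - 1`, Frobenius moves each
column to the next, and the last one wraps around to position `m - 1`. -/
theorem frobIdx_mem_range (hm : 0 < m) (k : Fin n) :
    (∃ i : Fin m, frobIdx hm k = newIdx n hm i ∧ (i : ℕ) = k) ∨
      ∃ k' : Fin n, frobIdx hm k = baseIdx hm k' := by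
  by_cases hk : (k : ℕ) < m
  · exact Or.inl ⟨⟨k, hk⟩, by simp [newIdx, frobIdx], rfl⟩
  · right
    have := k.2
    by_cases h : (k : ℕ) + 1 < n
    · refine ⟨⟨k + 1, h⟩, Prod.ext (Fin.ext ?_) ?_⟩
      · simp only [frobIdx, baseIdx_fst_val]
        split_ifs <;> omega
      · simp only [frobIdx, baseIdx_snd]
        split_ifs <;> omega
    · refine ⟨⟨m - 1, by omega⟩, Prod.ext (Fin.ext ?_) ?_⟩
      · simp only [frobIdx, baseIdx_fst_val]
        split_ifs <;> omega
      · simp only [frobIdx, baseIdx_snd]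
        split_ifs <;> omega

theorem exists_idx_eq_zero (n : ℕ) (hm : 0 < m) (i : Fin m) :
    (∃ k : Fin n, baseIdx hm k = (i, 0)) ∨ newIdx n hm i = (i, 0) := by
  by_cases h : (i : ℕ) < n
  · left
    have := i.2
    by_cases h' : n ≤ m ∨ (i : ℕ) + 1 < m
    · refine ⟨⟨i, h⟩, Prod.ext (Fin.ext ?_) ?_⟩
      · rw [baseIdx_fst_val, if_pos h']
      · rw [baseIdx_snd, if_pos h']
    -- Here `i = m - 1` and `m < n`: position `m - 1` holds a high power, and the plain vector is at
    -- position `m`.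
    · refine ⟨⟨m, by omega⟩, Prod.ext (Fin.ext ?_) ?_⟩
      · simp only [baseIdx_fst_val]
        split_ifs <;> omega
      · simp only [baseIdx_snd]
        split_ifs <;> omega
  · right
    simp [newIdx, h]

variable (F : Type u) [Field F] [Fintype F]

theorem baseCol_eq (hm : 0 < m) (k : Fin n) :
    baseCol F n hm k = powCol F n (baseIdx hm k).1 (baseIdx hm k).2 := by
  unfold baseCol baseIdx
  split_ifs <;> rfl

theorem newCol_eq (hm : 0 < m) (i : Fin m) :
    newCol F n hm i = powCol F n (newIdx n hm i).1 (newIdx n hm i).2 := by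
  unfold newCol newIdx
  split_ifs
  · ext1 r
    simp only [baseCol_eq, powCol, pow_succ, pow_mul]
  · rfl

theorem L0_eq (hm : 0 < m) : L0 F n hm = powMatrix F (baseIdx hm) := by
  ext1 r k
  simp [L0, powMatrix, baseCol_eq]

theorem ell0_eq (hm : 0 < m) : ell0 F n hm = (powMatrix F (baseIdx (n := n) hm)).det := by
  rw [ell0, L0_eq]

theorem ell_eq (hm : 0 < m) (i : Fin m) (j : Fin n) :
    ell F n hm i j =
      (powMatrix F (Function.update (baseIdx hm) j (newIdx n hm i))).det := by
  rw [ell, L0_eq, newCol_eq, powMatrix_updateCol]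

theorem ell0_ne_zero (hm : 0 < m) : ell0 F n hm ≠ 0 := by
  rw [ell0_eq]
  exact det_powMatrix_ne_zero F (baseIdx_injective hm)

end Indices

/-! ### Frobenius matrix and embeddings of F(mW) -/

section Generation

variable {F : Type u} [Field F] {m n : ℕ}

theorem ringHom_ext_of_X {Ω : Type*} [Field Ω] {f g : RatFun F m n →+* Ω}
    (hC : ∀ c : F, f (algebraMap F _ c) = g (algebraMap F _ c))
    (hX : ∀ p, f (algebraMap (Poly F m n) _ (X p)) = g (algebraMap (Poly F m n) _ (X p))) :
    f = g := by
  apply IsFractionRing.ringHom_ext (A := Poly F m n)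
  intro x
  refine RingHom.congr_fun (f := f.comp (algebraMap (Poly F m n) _))
    (g := g.comp (algebraMap (Poly F m n) _)) ?_ x
  apply MvPolynomial.ringHom_ext
  · intro c
    simp only [RingHom.comp_apply, ← MvPolynomial.algebraMap_eq,
      ← IsScalarTower.algebraMap_apply]
    exact hC c
  · exact hX

variable [Fintype F]

/-- X^q - X already has all its roots in F. -/
theorem exists_map_eq_of_pow_card_eq {Ω : Type*} [Field Ω] (φ : F →+* Ω) {a : Ω}
    (h : a ^ Fintype.card F = a) : ∃ c, φ c = a := by
  have hne : (Polynomial.X ^ Fintype.card F - Polynomial.X : Polynomial F) ≠ 0 :=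
    FiniteField.X_pow_card_sub_X_ne_zero F Fintype.one_lt_card
  have hs : (Polynomial.X ^ Fintype.card F - Polynomial.X : Polynomial F).Splits := by
    rw [Polynomial.splits_iff_card_roots, FiniteField.roots_X_pow_card_sub_X,
      FiniteField.X_pow_card_sub_X_natDegree_eq F Fintype.one_lt_card]
    rfl
  exact hs.mem_range_of_isRoot hne (by simp [Polynomial.IsRoot, h])

theorem map_pow_card_mul {Ω : Type*} [Field Ω] (φ : F →+* Ω) (A B : Matrix (Fin n) (Fin n) Ω) :
    (A * B).map (· ^ Fintype.card F) =
      A.map (· ^ Fintype.card F) * B.map (· ^ Fintype.card F) := by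
  let _ := φ.toAlgebra
  exact Matrix.map_mul (f := (FiniteField.frobeniusAlgHom F Ω : Ω →+* Ω))

variable (F) in
/-- `powMatrix` over the field of rational functions. -/
def fracMatrix (p : Fin n → Fin m × ℕ) : Matrix (Fin n) (Fin n) (RatFun F m n) :=
  (powMatrix F p).map (algebraMap (Poly F m n) (RatFun F m n))

theorem fracMatrix_apply (p : Fin n → Fin m × ℕ) (r k : Fin n) :
    fracMatrix F p r k =
      algebraMap (Poly F m n) (RatFun F m n) (X ((p k).1, r)) ^ (Fintype.card F ^ (p k).2) := by
  simp [fracMatrix, powMatrix_apply]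

theorem det_fracMatrix (p : Fin n → Fin m × ℕ) :
    (fracMatrix F p).det = algebraMap (Poly F m n) (RatFun F m n) (powMatrix F p).det :=
  (RingHom.map_det _ _).symm

theorem det_fracMatrix_ne_zero {p : Fin n → Fin m × ℕ} (hp : Function.Injective p) :
    (fracMatrix F p).det ≠ 0 := by
  rw [det_fracMatrix]
  simpa using det_powMatrix_ne_zero F hp

theorem fracMatrix_frobIdx (hm : 0 < m) :
    fracMatrix F (frobIdx (n := n) hm) =
      (fracMatrix F (baseIdx hm)).map (· ^ Fintype.card F) := by
  ext1 r k
  simp [fracMatrix_apply, frobIdx, pow_succ, pow_mul]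

variable (F) in
/-- The coordinates `ℓ_{ij} / ℓ_0` of `newCol` in terms of the columns of `L_0`. -/
def ratio (hm : 0 < m) (i : Fin m) (j : Fin n) : RatFun F m n :=
  algebraMap (Poly F m n) (RatFun F m n) (ell F n hm i j) /
    algebraMap (Poly F m n) (RatFun F m n) (ell0 F n hm)

theorem algebraMap_ell0_ne_zero (hm : 0 < m) :
    algebraMap (Poly F m n) (RatFun F m n) (ell0 F n hm) ≠ 0 := by
  simpa using ell0_ne_zero F hm

/-- Cramer's rule for L_0, divided by ℓ_0. -/
theorem newCol_eq_sum_ratio (hm : 0 < m) (i : Fin m) (r : Fin n) :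
    algebraMap (Poly F m n) (RatFun F m n) (X ((newIdx n hm i).1, r)) ^
        (Fintype.card F ^ (newIdx n hm i).2) =
      ∑ j, fracMatrix F (baseIdx hm) r j * ratio F hm i j := by
  have h := congrFun (Matrix.mulVec_cramer (L0 F n hm) (newCol F n hm i)) r
  simp only [Matrix.mulVec, dotProduct, Matrix.cramer_apply, Pi.smul_apply, smul_eq_mul] at h
  have h' := congrArg (algebraMap (Poly F m n) (RatFun F m n)) h
  simp only [map_sum, map_mul] at h'
  change _ = algebraMap (Poly F m n) (RatFun F m n) (ell0 F n hm) * _ at h'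
  have h0 := algebraMap_ell0_ne_zero (F := F) (n := n) hm
  apply mul_left_cancel₀ h0
  rw [newCol_eq, powCol, map_pow] at h'
  rw [← h', Finset.mul_sum]
  refine Finset.sum_congr rfl fun j _ => ?_
  rw [ratio, ell, newCol_eq, mul_left_comm, mul_div_cancel₀ _ h0, L0_eq]
  rfl

variable (F n) in
/-- The matrix `D` with `L_0^{(q)} = L_0 D`. -/
def frobCoeff (hm : 0 < m) : Matrix (Fin n) (Fin n) (RatFun F m n) :=
  (fracMatrix F (baseIdx hm))⁻¹ * fracMatrix F (frobIdx hm)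

theorem isUnit_det_base (hm : 0 < m) : IsUnit (fracMatrix F (baseIdx (n := n) hm)).det :=
  (det_fracMatrix_ne_zero (baseIdx_injective hm)).isUnit

theorem base_mul_frobCoeff (hm : 0 < m) :
    fracMatrix F (baseIdx hm) * frobCoeff F n hm = fracMatrix F (frobIdx hm) := by
  rw [frobCoeff, Matrix.mul_nonsing_inv_cancel_left _ _ (isUnit_det_base hm)]

theorem det_frobCoeff (hm : 0 < m) :
    (frobCoeff F n hm).det =
      algebraMap (Poly F m n) (RatFun F m n) (ell0 F n hm ^ (Fintype.card F - 1)) := by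
  have h := congrArg Matrix.det (base_mul_frobCoeff (F := F) (n := n) hm)
  have h1 : (fracMatrix F (frobIdx (n := n) hm)).det =
      (fracMatrix F (baseIdx (n := n) hm)).det ^ Fintype.card F := by
    rw [fracMatrix_frobIdx]
    exact (RingHom.map_det
      (FiniteField.frobeniusAlgHom F (RatFun F m n) : RatFun F m n →+* RatFun F m n) _).symm
  rw [Matrix.det_mul, h1, det_fracMatrix, ← ell0_eq] at h
  apply mul_left_cancel₀ (algebraMap_ell0_ne_zero (F := F) (n := n) hm)
  rw [h, map_pow, ← pow_succ', Nat.sub_add_cancel Fintype.card_pos]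

theorem frobCoeff_eq_of_col (hm : 0 < m) {k : Fin n} {c : Fin n → RatFun F m n}
    (h : ∀ r, fracMatrix F (frobIdx hm) r k = ∑ j, fracMatrix F (baseIdx hm) r j * c j)
    (j : Fin n) : frobCoeff F n hm j k = c j := by
  have h1 : (fun r => fracMatrix F (frobIdx hm) r k) = (fracMatrix F (baseIdx hm)).mulVec c := by
    ext1 r
    exact h r
  have h2 : frobCoeff F n hm j k =
      ((fracMatrix F (baseIdx hm))⁻¹.mulVec fun r => fracMatrix F (frobIdx hm) r k) j := rfl
  rw [h2, h1, Matrix.mulVec_mulVec, Matrix.nonsing_inv_mul _ (isUnit_det_base hm),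
    Matrix.one_mulVec]

theorem frobCoeff_col (hm : 0 < m) (k : Fin n) :
    (∃ i : Fin m, (i : ℕ) = k ∧ ∀ j, frobCoeff F n hm j k = ratio F hm i j) ∨
      ∃ k' : Fin n, ∀ j, frobCoeff F n hm j k = if j = k' then 1 else 0 := by
  rcases frobIdx_mem_range hm k with ⟨i, hi, hik⟩ | ⟨k', hk'⟩
  · refine Or.inl ⟨i, hik, frobCoeff_eq_of_col hm fun r => ?_⟩
    rw [← newCol_eq_sum_ratio, fracMatrix_apply, hi]
  · refine Or.inr ⟨k', frobCoeff_eq_of_col hm fun r => ?_⟩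
    simp [fracMatrix_apply, hk']

variable {E : IntermediateField F (RatFun F m n)}

theorem frobCoeff_mem (hm : 0 < m) (hE : ∀ i j, ratio F hm i j ∈ E) (j k : Fin n) :
    frobCoeff F n hm j k ∈ E := by
  rcases frobCoeff_col (F := F) hm k with ⟨i, -, h⟩ | ⟨k', h⟩
  · rw [h]
    exact hE i j
  · rw [h]
    split_ifs
    exacts [E.one_mem, E.zero_mem]

theorem exists_mem_algebraMap_X_eq (hm : 0 < m) (hE : ∀ i j, ratio F hm i j ∈ E) (i : Fin m) :
    ∃ c : Fin n → RatFun F m n, (∀ j, c j ∈ E) ∧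
      ∀ r, algebraMap (Poly F m n) (RatFun F m n) (X (i, r)) =
        ∑ j, fracMatrix F (baseIdx hm) r j * c j := by
  rcases exists_idx_eq_zero n hm i with ⟨k, hk⟩ | h
  · refine ⟨Pi.single k 1, fun j => ?_, fun r => ?_⟩
    · rw [Pi.single_apply]
      split_ifs
      exacts [E.one_mem, E.zero_mem]
    · simp [fracMatrix_apply, hk, Pi.single_apply]
  · refine ⟨ratio F hm i, hE i, fun r => ?_⟩
    rw [← newCol_eq_sum_ratio, h]
    simp

variable {W : Type v} [AddCommGroup W] [Module F W]

/-- A Lang-type descent: τ(Y) and ι(Y) solve the same equation Z^(q) = Z D, so they differ by a left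
factor over F. That factor also relates the images of all X_i, whose coordinates in terms of Y lie
in E. -/
theorem exists_actField_of_ringHom (b : Basis (Fin n) F W) (hm : 0 < m)
    (hE : ∀ i j, ratio F hm i j ∈ E) {Ω : Type*} [Field Ω] (ι τ : RatFun F m n →+* Ω)
    (hτ : ∀ x ∈ E, τ x = ι x) :
    ∃ σ : W ≃ₗ[F] W, ∀ x, τ x = ι (actField b m σ x) := by
  set Y := fracMatrix F (baseIdx (n := n) hm) with hY
  set D := frobCoeff F n hm with hD
  have hYq : Y.map (· ^ Fintype.card F) = Y * D := by
    rw [hY, hD, base_mul_frobCoeff, fracMatrix_frobIdx]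
  have hdY : Y.det ≠ 0 := det_fracMatrix_ne_zero (baseIdx_injective hm)
  have hdι : (Y.map ι).det ≠ 0 := by
    rw [← RingHom.mapMatrix_apply, ← RingHom.map_det]
    simpa using hdY
  have hdτ : (Y.map τ).det ≠ 0 := by
    rw [← RingHom.mapMatrix_apply, ← RingHom.map_det]
    simpa using hdY
  have hpow : ∀ f : RatFun F m n →+* Ω,
      (Y.map f).map (· ^ Fintype.card F) = Y.map f * D.map f := by
    intro f
    rw [← Matrix.map_mul, ← hYq]
    ext1
    simp
  have hDτ : D.map τ = D.map ι := by
    ext1 j k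
    exact hτ _ (frobCoeff_mem hm hE j k)
  set B := Y.map τ * (Y.map ι)⁻¹ with hB
  have hBY : B * Y.map ι = Y.map τ := by
    rw [hB, Matrix.nonsing_inv_mul_cancel_right _ _ hdι.isUnit]
  have hBq : B.map (· ^ Fintype.card F) = B := by
    -- Frobenius on B ι(Y) = τ(Y) gives B^(q) ι(Y) ι(D) = τ(Y) ι(D) = B ι(Y) ι(D); the invertible
    -- right factor cancels.
    have h1 := congrArg (fun M : Matrix _ _ Ω => M.map (· ^ Fintype.card F)) hBY
    simp only [map_pow_card_mul (ι.comp (algebraMap F (RatFun F m n))), hpow, hDτ] at h1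
    rw [← hBY, Matrix.mul_assoc] at h1
    have hu : IsUnit (Y.map ι * D.map ι) := by
      rw [← hpow, Matrix.isUnit_iff_isUnit_det]
      have : ((Y.map ι).map (· ^ Fintype.card F)).det = (Y.map ι).det ^ Fintype.card F := by
        let _ := (ι.comp (algebraMap F (RatFun F m n))).toAlgebra
        exact (RingHom.map_det (FiniteField.frobeniusAlgHom F Ω : Ω →+* Ω) _).symm
      rw [this]
      exact (pow_ne_zero _ hdι).isUnit
    exact hu.mul_right_cancel h1
  have hex : ∀ r s, ∃ c : F, ι (algebraMap F (RatFun F m n) c) = B r s := fun r s =>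
    exists_map_eq_of_pow_card_eq (ι.comp (algebraMap F (RatFun F m n)))
      (congrFun (congrFun hBq r) s)
  choose A hA using hex
  have hAB : (Matrix.of A).map (ι.comp (algebraMap F (RatFun F m n))) = B := by
    ext1 r s
    exact hA r s
  have hdA : IsUnit (Matrix.of A).det := by
    rw [isUnit_iff_ne_zero]
    intro h0
    have hdB : B.det = 0 := by
      rw [← hAB, ← RingHom.mapMatrix_apply, ← RingHom.map_det, h0, map_zero]
    apply hdτ
    rw [← hBY, Matrix.det_mul, hdB, zero_mul]
  -- The inverse appears because coordinates transform by the matrix of σ⁻¹.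
  let σ : W ≃ₗ[F] W := (Matrix.toLinearEquiv b (Matrix.of A) hdA)⁻¹
  have hσ : invMatrix b σ = Matrix.of A := by
    rw [invMatrix, inv_inv]
    exact LinearMap.toMatrix_toLin b b _
  refine ⟨σ, fun x => ?_⟩
  refine RingHom.congr_fun (f := τ) (g := ι.comp (actField b m σ : RatFun F m n →+* RatFun F m n))
    (ringHom_ext_of_X (fun c => ?_) fun p => ?_) x
  · rw [hτ _ (E.algebraMap_mem c)]
    simp
  · obtain ⟨i, r⟩ := p
    obtain ⟨c, hc, hX⟩ := exists_mem_algebraMap_X_eq hm hE i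
    have h1 : actField b m σ (algebraMap (Poly F m n) (RatFun F m n) (X (i, r))) =
        algebraMap (Poly F m n) (RatFun F m n) (act b m σ (X (i, r))) := by
      simp [actField]
    have h2 : ι.comp (actField b m σ : RatFun F m n →+* RatFun F m n)
        (algebraMap (Poly F m n) (RatFun F m n) (X (i, r))) = ∑ s, B r s *
          ι (algebraMap (Poly F m n) (RatFun F m n) (X (i, s))) := by
      rw [RingHom.comp_apply]
      erw [h1]
      rw [act_X, hσ, map_sum, map_sum]
      refine Finset.sum_congr rfl fun s _ => ?_
      rw [map_mul, map_mul, ← hA, ← IsScalarTower.algebraMap_apply]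
      rfl
    rw [h2]
    simp only [hX, map_sum, map_mul, Finset.mul_sum]
    rw [Finset.sum_comm]
    refine Finset.sum_congr rfl fun j _ => ?_
    have h3 := congrFun (congrFun hBY r) j
    simp only [Matrix.mul_apply, Matrix.map_apply] at h3
    rw [← h3, hτ _ (hc j), Finset.sum_mul]
    exact Finset.sum_congr rfl fun s _ => mul_assoc _ _ _

end Generation

/-! ### Separability, Galois descent and the omitted generator -/

section Separable

variable {F : Type u} [Field F] {m n : ℕ} {E : IntermediateField F (RatFun F m n)}

instance essFiniteType_ratFun : Algebra.EssFiniteType E (RatFun F m n) :=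
  haveI : Algebra.EssFiniteType (Poly F m n) (RatFun F m n) :=
    Algebra.EssFiniteType.of_isLocalization (RatFun F m n) (nonZeroDivisors (Poly F m n))
  haveI : Algebra.EssFiniteType F (RatFun F m n) :=
    Algebra.EssFiniteType.comp F (Poly F m n) (RatFun F m n)
  Algebra.EssFiniteType.of_comp F E (RatFun F m n)

theorem derivation_eq_zero_of_X {M : Type*} [AddCommGroup M] [Module (RatFun F m n) M]
    [Module E M] [IsScalarTower E (RatFun F m n) M] (d : Derivation E (RatFun F m n) M)
    (hX : ∀ p, d (algebraMap (Poly F m n) (RatFun F m n) (X p)) = 0) (x : RatFun F m n) :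
    d x = 0 := by
  have hpoly : ∀ f : Poly F m n, d (algebraMap (Poly F m n) (RatFun F m n) f) = 0 := by
    intro f
    induction f using MvPolynomial.induction_on with
    | C c =>
      have h : algebraMap (Poly F m n) (RatFun F m n) (C c) =
          algebraMap E (RatFun F m n) (algebraMap F E c) := by
        rw [← MvPolynomial.algebraMap_eq, ← IsScalarTower.algebraMap_apply,
          ← IsScalarTower.algebraMap_apply]
      rw [h, d.map_algebraMap]
    | add f g hf hg => rw [map_add, map_add, hf, hg, add_zero]
    | mul_X f p hf => rw [map_mul, d.leibniz, hf, hX, smul_zero, smul_zero, add_zero]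
  obtain ⟨f, g, hg, rfl⟩ := IsFractionRing.div_surjective (Poly F m n) x
  have hg0 : algebraMap (Poly F m n) (RatFun F m n) g ≠ 0 := by
    simpa using nonZeroDivisors.ne_zero hg
  have h := d.leibniz (algebraMap (Poly F m n) (RatFun F m n) g)
    (algebraMap (Poly F m n) (RatFun F m n) f / algebraMap (Poly F m n) (RatFun F m n) g)
  rw [mul_div_cancel₀ _ hg0, hpoly, hpoly, smul_zero, add_zero] at h
  exact (smul_eq_zero.mp h.symm).resolve_left hg0

variable [Fintype F]

theorem derivation_eq_zero {M : Type*} [AddCommGroup M] [Module (RatFun F m n) M]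
    [Module E M] [IsScalarTower E (RatFun F m n) M] (hm : 0 < m)
    (hE : ∀ i j, ratio F hm i j ∈ E) (d : Derivation E (RatFun F m n) M) (x : RatFun F m n) :
    d x = 0 := by
  have hdE : ∀ c ∈ E, d c = 0 := fun c hc => d.map_algebraMap ⟨c, hc⟩
  have hq : ((Fintype.card F : ℕ) : RatFun F m n) = 0 := by
    have h := congrArg (algebraMap F (RatFun F m n)) (FiniteField.cast_card_eq_zero F)
    rwa [map_natCast, map_zero] at h
  have hY : ∀ r k, d (fracMatrix F (baseIdx hm) r k) = 0 := by
    intro r k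
    set D := frobCoeff F n hm with hD
    have hu : IsUnit D.det := by
      rw [hD, det_frobCoeff, map_pow]
      exact (pow_ne_zero _ (algebraMap_ell0_ne_zero hm)).isUnit
    have h : ∀ l, ∑ j, D j l • d (fracMatrix F (baseIdx hm) r j) = 0 := by
      intro l
      have h1 := congrArg d (congrFun (congrFun (base_mul_frobCoeff (F := F) hm) r) l)
      -- The derivative of a q-th power vanishes because q = 0 in the field.
      rw [fracMatrix_frobIdx, Matrix.map_apply, d.leibniz_pow, ← Nat.cast_smul_eq_nsmul
        (RatFun F m n), hq, zero_smul, Matrix.mul_apply, map_sum] at h1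
      rw [← h1]
      refine Finset.sum_congr rfl fun j _ => ?_
      rw [d.leibniz, hdE _ (frobCoeff_mem hm hE j l), smul_zero, zero_add]
    have h2 : ∑ l, D⁻¹ l k • ∑ j, D j l • d (fracMatrix F (baseIdx hm) r j) = 0 := by
      simp [h]
    simp only [Finset.smul_sum, smul_smul] at h2
    rw [Finset.sum_comm] at h2
    have h3 : ∀ j, ∑ l, (D⁻¹ l k * D j l) • d (fracMatrix F (baseIdx hm) r j) =
        (1 : Matrix (Fin n) (Fin n) (RatFun F m n)) j k • d (fracMatrix F (baseIdx hm) r j) := by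
      intro j
      rw [← Finset.sum_smul, ← Matrix.mul_nonsing_inv D hu, Matrix.mul_apply]
      simp only [mul_comm]
    simpa [h3, Matrix.one_apply, ite_smul] using h2
  refine derivation_eq_zero_of_X d (fun p => ?_) x
  obtain ⟨c, hc, h⟩ := exists_mem_algebraMap_X_eq hm hE p.1
  rw [h p.2, map_sum]
  refine Finset.sum_eq_zero fun j _ => ?_
  rw [d.leibniz, hY, hdE _ (hc j), smul_zero, smul_zero, add_zero]

/-- The Kähler differentials vanish, so K is formally unramified over E; as K is essentially of
finite type over E, this means separable. -/
theorem isSeparable_ratFun (hm : 0 < m) (hE : ∀ i j, ratio F hm i j ∈ E) :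
    Algebra.IsSeparable E (RatFun F m n) := by
  rw [← Algebra.FormallyUnramified.iff_isSeparable]
  refine ⟨?_⟩
  rw [← Submodule.subsingleton_iff (RatFun F m n), ← subsingleton_iff_bot_eq_top,
    ← KaehlerDifferential.span_range_derivation, eq_comm, Submodule.span_eq_bot]
  rintro _ ⟨x, rfl⟩
  exact derivation_eq_zero hm hE _ x

variable {W : Type v} [AddCommGroup W] [Module F W]

theorem mem_of_forall_actField_eq (b : Basis (Fin n) F W) (hm : 0 < m)
    (hE : ∀ i j, ratio F hm i j ∈ E) {x : RatFun F m n}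
    (hx : ∀ σ, (∀ y ∈ E, actField b m σ y = y) → actField b m σ x = x) : x ∈ E := by
  have := isSeparable_ratFun hm hE
  by_contra hxE
  set Ω := AlgebraicClosure (RatFun F m n)
  have : Algebra.IsAlgebraic E Ω := Algebra.IsAlgebraic.trans E (RatFun F m n) Ω
  have : IsAlgClosure E Ω := ⟨inferInstance, inferInstance⟩
  have : Normal E Ω := IsAlgClosure.normal E Ω
  have hsep : IsSeparable E (algebraMap (RatFun F m n) Ω x) :=
    (Algebra.IsSeparable.isSeparable E x).map (f := IsScalarTower.toAlgHom E (RatFun F m n) Ω)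
      (algebraMap (RatFun F m n) Ω).injective
  have hnot : algebraMap (RatFun F m n) Ω x ∉ (⊥ : Subalgebra E Ω) := by
    rintro ⟨y, hy⟩
    apply hxE
    have : algebraMap (RatFun F m n) Ω y = algebraMap (RatFun F m n) Ω x := hy
    rw [← (algebraMap (RatFun F m n) Ω).injective this]
    exact y.2
  -- A separable element outside E has a second conjugate; an automorphism g of Ω over E reaching it
  -- restricts on K to some σ that fixes E, hence fixes x.
  obtain ⟨y, hne, hconj⟩ := (notMem_iff_exists_ne_and_isConjRoot hsep
    (IsAlgClosed.splits _)).mp hnot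
  obtain ⟨g, hg⟩ := hconj.symm.exists_algEquiv
  obtain ⟨σ, hσ⟩ := exists_actField_of_ringHom b hm hE (algebraMap (RatFun F m n) Ω)
    ((g : Ω →+* Ω).comp (algebraMap (RatFun F m n) Ω)) (fun z hz => g.commutes ⟨z, hz⟩)
  have hfix : ∀ z ∈ E, actField b m σ z = z := fun z hz =>
    (algebraMap (RatFun F m n) Ω).injective ((hσ z).symm.trans (g.commutes ⟨z, hz⟩))
  apply hne
  rw [← hg]
  have := hσ x
  rw [hx σ hfix] at this
  exact this.symm

theorem invariantField_eq (b : Basis (Fin n) F W) (hm : 0 < m)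
    (G : Subgroup (W ≃ₗ[F] W)) (hle : E ≤ invariantField b m G) (hE : ∀ i j, ratio F hm i j ∈ E)
    (hG : ∀ σ, (∀ y ∈ E, actField b m σ y = y) → σ ∈ G) : invariantField b m G = E := by
  refine le_antisymm (fun x hx => mem_of_forall_actField_eq b hm hE fun σ hσ => ?_) hle
  exact hx ⟨actField b m σ, Subgroup.mem_map_of_mem _ (hG σ hσ)⟩

theorem ratio_mem_of_omitted (hm : 0 < m) {a : Fin m × Fin n} (ha : Omittable a)
    (h0 : algebraMap (Poly F m n) (RatFun F m n) (ell0 F n hm ^ (Fintype.card F - 1)) ∈ E)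
    (hE : ∀ i j, (i, j) ≠ a → ratio F hm i j ∈ E) (i : Fin m) (j : Fin n) :
    ratio F hm i j ∈ E := by
  by_cases hij : (i, j) = a
  swap
  · exact hE i j hij
  subst hij
  set D := frobCoeff F n hm with hD
  set k : Fin n := ⟨i, ha.1⟩ with hk
  have hmem : ∀ s t, (t = k → s ≠ j) → D s t ∈ E := by
    intro s t hst
    rcases frobCoeff_col (F := F) hm t with ⟨i', hi', h⟩ | ⟨k', h⟩
    · rw [hD, h]
      refine hE i' s fun h' => ?_
      simp only [Prod.mk.injEq] at h'
      exact hst (Fin.ext (by rw [← hi', h'.1])) h'.2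
    · rw [hD, h]
      split_ifs
      exacts [E.one_mem, E.zero_mem]
  -- The cofactors along column `k` avoid that column, hence the unknown entry.
  have hupd : ∀ s, (D.updateCol k (Pi.single s 1)).det ∈ E := by
    intro s
    rw [Matrix.det_apply]
    refine sum_mem fun π _ => ?_
    rw [Units.smul_def, zsmul_eq_mul]
    refine mul_mem (by simp) (prod_mem fun t _ => ?_)
    rw [Matrix.updateCol_apply]
    split_ifs with htk
    · rw [Pi.single_apply]
      split_ifs
      exacts [E.one_mem, E.zero_mem]
    · exact hmem _ _ fun h => absurd h htk
  have hsum : D.det = ∑ s, D s k * (D.updateCol k (Pi.single s 1)).det := by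
    have h := congrFun (LinearMap.pi_apply_eq_sum_univ (Matrix.cramer D) fun s => D s k) k
    rw [Matrix.cramer_row_self D _ k fun _ => rfl, Pi.single_eq_same] at h
    rw [h, Finset.sum_apply]
    refine Finset.sum_congr rfl fun s _ => ?_
    rw [Pi.smul_apply, Matrix.cramer_apply, smul_eq_mul]
    congr 3
    ext1 t
    simp [Pi.single_apply, eq_comm]
  -- Multiplying by Y turns this cofactor into the determinant of L_0^(q) with column `k` replaced
  -- by column `j` of L_0, whose columns are still distinct powers.
  have hne : (D.updateCol k (Pi.single j 1)).det ≠ 0 := by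
    intro hz
    have h := congrArg Matrix.det
      (Matrix.mul_updateCol (fracMatrix F (baseIdx hm)) D k (Pi.single j 1))
    rw [Matrix.det_mul, hz, mul_zero, hD, base_mul_frobCoeff] at h
    refine det_fracMatrix_ne_zero (F := F) (update_frobIdx_injective hm ha) (h.trans ?_).symm
    congr 1
    ext1 r l
    by_cases hl : l = k
    · subst hl
      simp [fracMatrix_apply, hk]
    · rw [Matrix.updateCol_ne hl, fracMatrix_apply, fracMatrix_apply, Function.update_of_ne hl]
  have hjk : D j k ∈ E := by
    rw [← Finset.add_sum_erase _ _ (Finset.mem_univ j)] at hsum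
    have h1 : D j k = (D.det - ∑ s ∈ Finset.univ.erase j,
        D s k * (D.updateCol k (Pi.single s 1)).det) / (D.updateCol k (Pi.single j 1)).det := by
      rw [hsum, add_sub_cancel_right, mul_div_cancel_right₀ _ hne]
    rw [h1]
    refine div_mem (sub_mem ?_ (sum_mem fun s hs => mul_mem (hmem _ _ fun _ =>
      Finset.ne_of_mem_erase hs) (hupd s))) (hupd j)
    rw [hD, det_frobCoeff]
    exact h0
  have hcol : D j k = ratio F hm i j := by
    refine frobCoeff_eq_of_col hm (fun r => ?_) j
    rw [← newCol_eq_sum_ratio, fracMatrix_apply]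
    simp [newIdx, frobIdx, hk, ha.1]
  rwa [← hcol]

end Separable

/-! ### Invariance, homogeneity and the two groups -/

section Main

variable {F : Type u} [Field F] {m n : ℕ} {W : Type v} [AddCommGroup W] [Module F W]

theorem exists_omittable (hm : 0 < m) (hn : 0 < n) : ∃ a : Fin m × Fin n, Omittable a := by
  rcases lt_or_ge m n with h | h
  · exact ⟨(⟨0, hm⟩, ⟨m, h⟩), hn, fun _ => Or.inr rfl⟩
  · exact ⟨(⟨0, hm⟩, ⟨0, hn⟩), hn, fun h' => absurd h' (by omega)⟩

theorem adjoin_le_invariantField (b : Basis (Fin n) F W) (G : Subgroup (W ≃ₗ[F] W)) {ι : Type*}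
    {f : ι → Poly F m n} (hf : ∀ p, f p ∈ invariantRing b m G) :
    IntermediateField.adjoin F (Set.range fun p => algebraMap (Poly F m n) (RatFun F m n) (f p)) ≤
      invariantField b m G := by
  rw [IntermediateField.adjoin_le_iff]
  rintro _ ⟨p, rfl⟩ ⟨_, σ, hσ, rfl⟩
  change actField b m σ _ = _
  simp only [actField, MonoidHom.comp_apply, IsFractionRing.fieldEquivOfAlgEquivHom_apply,
    IsFractionRing.fieldEquivOfAlgEquiv_algebraMap]
  rw [hf p σ hσ]

theorem GenerateInvariants.comp_equiv {b : Basis (Fin n) F W} {G : Subgroup (W ≃ₗ[F] W)}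
    {ι κ : Type*} {f : ι → Poly F m n} (h : GenerateInvariants b G f) (e : κ ≃ ι) :
    GenerateInvariants b G (f ∘ e) := by
  refine ⟨fun p => h.1 (e p), h.2.trans ?_⟩
  congr 1
  exact (e.surjective.range_comp fun p => algebraMap (Poly F m n) (RatFun F m n) (f p)).symm

theorem det_invMatrix_of_mem_SLgroup (b : Basis (Fin n) F W) {σ : W ≃ₗ[F] W}
    (hσ : σ ∈ SLgroup F W) : (invMatrix b σ).det = 1 := by
  rw [det_invMatrix, show LinearEquiv.det σ = 1 from hσ]
  simp

variable [Fintype F]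

theorem isHomogeneous_ell0 (hm : 0 < m) : ∃ d, (ell0 F n hm).IsHomogeneous d :=
  ⟨_, ell0_eq F (n := n) hm ▸ isHomogeneous_det_powMatrix F _⟩

theorem isHomogeneous_ell (hm : 0 < m) (i : Fin m) (j : Fin n) :
    ∃ d, (ell F n hm i j).IsHomogeneous d :=
  ⟨_, ell_eq F hm i j ▸ isHomogeneous_det_powMatrix F _⟩

theorem act_ell0 (b : Basis (Fin n) F W) (hm : 0 < m) (σ : W ≃ₗ[F] W) :
    act b m σ (ell0 F n hm) =
      algebraMap F (Poly F m n) (invMatrix b σ).det * ell0 F n hm := by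
  rw [ell0_eq, act_det_powMatrix]

theorem act_ell (b : Basis (Fin n) F W) (hm : 0 < m) (σ : W ≃ₗ[F] W) (i : Fin m) (j : Fin n) :
    act b m σ (ell F n hm i j) =
      algebraMap F (Poly F m n) (invMatrix b σ).det * ell F n hm i j := by
  rw [ell_eq, act_det_powMatrix]

theorem invMatrix_det_pow_card_sub_one (b : Basis (Fin n) F W) (σ : W ≃ₗ[F] W) :
    (invMatrix b σ).det ^ (Fintype.card F - 1) = 1 := by
  apply FiniteField.pow_card_sub_one_eq_one
  rw [det_invMatrix]
  exact Units.ne_zero _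

theorem ell0_pow_mem_invariantRing (b : Basis (Fin n) F W) (hm : 0 < m)
    (G : Subgroup (W ≃ₗ[F] W)) :
    ell0 F n hm ^ (Fintype.card F - 1) ∈ invariantRing b m G := by
  intro σ _
  rw [map_pow, act_ell0, mul_pow, ← map_pow, invMatrix_det_pow_card_sub_one, map_one, one_mul]

theorem ell0_pow_mul_ell_mem_invariantRing (b : Basis (Fin n) F W) (hm : 0 < m)
    (G : Subgroup (W ≃ₗ[F] W)) (i : Fin m) (j : Fin n) :
    ell0 F n hm ^ (Fintype.card F - 2) * ell F n hm i j ∈ invariantRing b m G := by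
  intro σ _
  have hq : Fintype.card F - 2 + 1 = Fintype.card F - 1 := by
    have : 1 < Fintype.card F := Fintype.one_lt_card
    omega
  rw [map_mul, map_pow, act_ell0, act_ell, mul_pow, mul_mul_mul_comm, ← map_pow, ← map_mul,
    ← pow_succ, hq, invMatrix_det_pow_card_sub_one, map_one, one_mul]

theorem mem_SLgroup_of_actField_ell0 (b : Basis (Fin n) F W) (hm : 0 < m) {σ : W ≃ₗ[F] W}
    (h : actField b m σ (algebraMap (Poly F m n) (RatFun F m n) (ell0 F n hm)) =
      algebraMap (Poly F m n) (RatFun F m n) (ell0 F n hm)) : σ ∈ SLgroup F W := by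
  have h1 : act b m σ (ell0 F n hm) = ell0 F n hm := by
    apply IsFractionRing.injective (Poly F m n) (RatFun F m n)
    rw [← h]
    simp [actField]
  rw [act_ell0] at h1
  have h2 := mul_right_cancel₀ (ell0_ne_zero F hm) (h1.trans (one_mul _).symm)
  rw [← map_one (algebraMap F (Poly F m n))] at h2
  have h3 := (algebraMap F (Poly F m n)).injective h2
  rw [det_invMatrix, Units.val_eq_one, inv_eq_one] at h3
  exact h3

theorem generateInvariants_genGL (b : Basis (Fin n) F W) (hm : 0 < m) {a : Fin m × Fin n}
    (ha : Omittable a) : GenerateInvariants b (GLgroup F W) (genGL F n hm a) := by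
  have hinv : ∀ p, genGL F n hm a p ∈ invariantRing b m (GLgroup F W) := by
    intro p
    unfold genGL
    split_ifs
    exacts [ell0_pow_mem_invariantRing b hm _, ell0_pow_mul_ell_mem_invariantRing b hm _ _ _]
  refine ⟨fun p => ⟨?_, hinv p⟩, ?_⟩
  · obtain ⟨d, hd⟩ := isHomogeneous_ell0 (F := F) (n := n) hm
    obtain ⟨e, he⟩ := isHomogeneous_ell (F := F) (n := n) hm p.1 p.2
    unfold genGL
    split_ifs
    exacts [⟨_, hd.pow _⟩, ⟨_, (hd.pow _).mul he⟩]
  · have hgen : ∀ p, algebraMap (Poly F m n) (RatFun F m n) (genGL F n hm a p) ∈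
        IntermediateField.adjoin F
          (Set.range fun p => algebraMap (Poly F m n) (RatFun F m n) (genGL F n hm a p)) :=
      fun p => IntermediateField.subset_adjoin _ _ ⟨p, rfl⟩
    have h0 := hgen a
    rw [genGL, if_pos rfl] at h0
    refine invariantField_eq b hm _ (adjoin_le_invariantField b _ hinv)
      (ratio_mem_of_omitted hm ha h0 fun i j hij => ?_) fun σ _ => Subgroup.mem_top σ
    have h1 := hgen (i, j)
    rw [genGL, if_neg hij] at h1
    have h2 := div_mem h1 h0
    have hq : Fintype.card F - 1 = Fintype.card F - 2 + 1 := by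
      have : 1 < Fintype.card F := Fintype.one_lt_card
      omega
    -- The quotient of ℓ_0^(q-2) ℓ_ij by ℓ_0^(q-1) is the ratio ℓ_ij/ℓ_0.
    rw [hq, pow_succ, map_mul, map_mul, mul_div_mul_left] at h2
    · exact h2
    · rw [map_pow]
      exact pow_ne_zero _ (algebraMap_ell0_ne_zero hm)

theorem generateInvariants_genSL (b : Basis (Fin n) F W) (hm : 0 < m) {a : Fin m × Fin n}
    (ha : Omittable a) : GenerateInvariants b (SLgroup F W) (genSL F n hm a) := by
  have hinv : ∀ p, genSL F n hm a p ∈ invariantRing b m (SLgroup F W) := by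
    intro p σ hσ
    unfold genSL
    split_ifs
    · rw [act_ell0, det_invMatrix_of_mem_SLgroup b hσ, map_one, one_mul]
    · rw [act_ell, det_invMatrix_of_mem_SLgroup b hσ, map_one, one_mul]
  refine ⟨fun p => ⟨?_, hinv p⟩, ?_⟩
  · unfold genSL
    split_ifs
    exacts [isHomogeneous_ell0 hm, isHomogeneous_ell hm _ _]
  · have hgen : ∀ p, algebraMap (Poly F m n) (RatFun F m n) (genSL F n hm a p) ∈
        IntermediateField.adjoin F
          (Set.range fun p => algebraMap (Poly F m n) (RatFun F m n) (genSL F n hm a p)) :=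
      fun p => IntermediateField.subset_adjoin _ _ ⟨p, rfl⟩
    have h0 := hgen a
    rw [genSL, if_pos rfl] at h0
    refine invariantField_eq b hm _ (adjoin_le_invariantField b _ hinv)
      (ratio_mem_of_omitted hm ha (by rw [map_pow]; exact pow_mem h0 _) fun i j hij => ?_)
      fun σ hσ => mem_SLgroup_of_actField_ell0 b hm (hσ _ h0)
    have h1 := hgen (i, j)
    rw [genSL, if_neg hij] at h1
    exact div_mem h1 h0

/-- For n = 0 there are no ratios to supply and W is zero, so its only automorphism is the identity.
-/
theorem generateInvariants_of_isEmpty (b : Basis (Fin 0) F W) (hm : 0 < m)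
    (G : Subgroup (W ≃ₗ[F] W)) {ι : Type*} [IsEmpty ι] (f : ι → Poly F m 0) :
    GenerateInvariants b G f := by
  refine ⟨isEmptyElim, invariantField_eq b hm G (adjoin_le_invariantField b G isEmptyElim)
    (fun i j => j.elim0) fun σ _ => ?_⟩
  have : Subsingleton W := b.repr.toEquiv.subsingleton
  rw [show σ = 1 from LinearEquiv.ext fun x => Subsingleton.elim _ _]
  exact G.one_mem

end Main

end VectorInvariants

end
theorem theorem1p2 {F : Type*} [Field F] [Fintype F] {W : Type*} [AddCommGroup W] [Module F W]
    {m n : ℕ} (hm : 0 < m) (b : Module.Basis (Fin n) F W) :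
    (∃ f : Fin (m * n) → VectorInvariants.Poly F m n,
        VectorInvariants.GenerateInvariants b (VectorInvariants.GLgroup F W) f) ∧
    (∃ f : Fin (m * n) → VectorInvariants.Poly F m n,
        VectorInvariants.GenerateInvariants b (VectorInvariants.SLgroup F W) f) ∧
    (0 < n → ∃ a : Fin m × Fin n, VectorInvariants.Omittable a) ∧
    ∀ a : Fin m × Fin n, VectorInvariants.Omittable a →
      VectorInvariants.GenerateInvariants b (VectorInvariants.GLgroup F W)
        (VectorInvariants.genGL F n hm a) ∧
      VectorInvariants.GenerateInvariants b (VectorInvariants.SLgroup F W)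
        (VectorInvariants.genSL F n hm a) := by
  refine ⟨?_, ?_, VectorInvariants.exists_omittable hm, fun a ha =>
    ⟨VectorInvariants.generateInvariants_genGL b hm ha,
      VectorInvariants.generateInvariants_genSL b hm ha⟩⟩ <;>
  rcases Nat.eq_zero_or_pos n with rfl | hn
  · have : IsEmpty (Fin (m * 0)) := by rw [mul_zero]; infer_instance
    exact ⟨0, VectorInvariants.generateInvariants_of_isEmpty b hm _ _⟩
  · obtain ⟨a, ha⟩ := VectorInvariants.exists_omittable hm hn
    exact ⟨_, (VectorInvariants.generateInvariants_genGL b hm ha).comp_equiv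
      finProdFinEquiv.symm⟩
  · have : IsEmpty (Fin (m * 0)) := by rw [mul_zero]; infer_instance
    exact ⟨0, VectorInvariants.generateInvariants_of_isEmpty b hm _ _⟩
  · obtain ⟨a, ha⟩ := VectorInvariants.exists_omittable hm hn
    exact ⟨_, (VectorInvariants.generateInvariants_genSL b hm ha).comp_equiv
      finProdFinEquiv.symm⟩
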